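/- Let $a,b$ be integers with $2\le a\le b-2$, let $\rho$ be a root of the polynomial $$x^3-(a+b)x^2+abx-1,$$ and let $K=\mathbb{Q}(\rho)$ (a totally real cubic field). An element $\alpha\in K$ is called totally positive if $\sigma(\alpha)>0$ for every embedding $\sigma:K\to\mathbb{R}$. An element $\alpha\in\mathbb{Z}[\rho]$ is called indecomposable in $\mathbb{Z}[\rho]$ if it is totally positive and cannot be written as $\alpha=\beta+\gamma$ with totally positive $\beta,\gamma\in\mathbb{Z}[\rho]$. Then, up to multiplication by totally positive units of $\mathbb{Z}[\rho]$, the indecomposable elements of $\mathbb{Z}[\rho]$ are exactly the elements $$-v+(bw+1)\rho-w\rho^2,\qquad v,w\in\mathbb{Z},\quad 0\le v\le b-a-1,\quad va\le w\le (v+1)a-1.$$ That is, $\alpha\in K$ is indecomposable in $\mathbb{Z}[\rho]$ if and only if $\alpha=\varepsilon\,\bigl(-v+(bw+1)\rho-w\rho^2\bigr)$ for some $v,w$ as above and some totally positive unit $\varepsilon$ of $\mathbb{Z}[\rho]$. -/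

import Mathlib

open Polynomial

/-- The polynomial `x³ - (a + b) x² + a b x - 1` with integer coefficients. -/
noncomputable def thomasCubic (a b : ℤ) : ℤ[X] :=
  X ^ 3 - C (a + b) * X ^ 2 + C (a * b) * X - 1

/-- An element of a (totally real) number field `K` is totally positive if it is sent to a
positive number by every embedding of `K` into `ℝ`. -/
def TotallyPositive {K : Type*} [Field K] (x : K) : Prop :=
  ∀ σ : K →+* ℝ, 0 < σ x

/-- `x` is indecomposable in the order `O`: it is a totally positive element of `O` which is not
the sum of two totally positive elements of `O`. -/
def IndecomposableIn {K : Type*} [Field K] (O : Subalgebra ℤ K) (x : K) : Prop :=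
  x ∈ O ∧ TotallyPositive x ∧
    ¬ ∃ y z : K, y ∈ O ∧ TotallyPositive y ∧ z ∈ O ∧ TotallyPositive z ∧ x = y + z

/-! Put `u = ρ (ρ - b)²`. Then `ρ` and `u` are totally positive units, and the translates of the
cone spanned by `1, ρ, u, ρu` under the units `ρⁿ uᵐ` cover the positive octant
(`exists_zpow_mem_cone`). Up to such a unit, a totally positive element is therefore a lattice point
of this cone.

In coordinates `x + kρ + wρ(b - ρ)` the edges are `(1,0,0)`, `(0,1,0)`, `(1,0,b-a)` and
`(-(b-a),1,a(b-a))`, and the four faces give the inequalities of `InCone`. A lattice point that is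
neither on a short list nor in the triangle `k = 1`, `0 ≤ ax + w ≤ a - 1` splits inside the cone
(`InCone.cases`). Each point on the short list is a unit times a point of the triangle.

Conversely, points of the triangle have `k = 1`, so in any decomposition one summand has `k ≤ 0`.
Total positivity bounds `k + rᵢ(ax + w)` below for the two smaller roots, which excludes such a
summand (`coord_pos`, `false_of_add`). -/

/-! ### Inequalities for powers -/

/-- Exponential growth: for `0 < p < q` the sequence `D q ^ n` eventually exceeds `C p ^ n`. -/
theorem exists_zpow_lt_zpow {p q : ℝ} (hp : 0 < p) (hpq : p < q) (C : ℝ) {D : ℝ} (hD : 0 < D) :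
    ∃ N : ℤ, ∀ n : ℤ, N ≤ n → C * p ^ n < D * q ^ n := by
  have h1 : 1 < q / p := (one_lt_div hp).2 hpq
  obtain ⟨k, hk⟩ := pow_unbounded_of_one_lt (C / D) h1
  refine ⟨k, fun n hn => ?_⟩
  have h2 : (q / p) ^ (k : ℤ) ≤ (q / p) ^ n := zpow_le_zpow_right₀ h1.le hn
  rw [zpow_natCast] at h2
  have h3 : C / D < q ^ n / p ^ n := by rw [← div_zpow]; exact hk.trans_le h2
  have hpn : 0 < p ^ n := zpow_pos hp n
  rw [div_lt_div_iff₀ hD hpn] at h3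
  linarith

/-- The version of `exists_zpow_lt_zpow` for negative exponents. -/
theorem exists_zpow_lt_zpow_neg {p q : ℝ} (hp : 0 < p) (hpq : p < q) {C : ℝ} (D : ℝ)
    (hC : 0 < C) : ∃ N : ℤ, ∀ n : ℤ, n ≤ N → D * q ^ n < C * p ^ n := by
  obtain ⟨N, hN⟩ := exists_zpow_lt_zpow (inv_pos.2 (hp.trans hpq))
    (inv_strictAnti₀ hp hpq) D hC
  refine ⟨-N, fun n hn => ?_⟩
  simpa [inv_zpow, zpow_neg] using hN (-n) (by omega)

/-- Bernoulli's inequality for integer exponents. -/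
theorem one_add_mul_sub_le_zpow {s : ℝ} (hs : 0 < s) (m : ℤ) : 1 + m * (s - 1) ≤ s ^ m := by
  obtain ⟨k, rfl | rfl⟩ := m.eq_nat_or_neg
  · rw [zpow_natCast]
    have := one_add_mul_le_pow (a := s - 1) (by linarith) k
    simpa using this
  · rw [zpow_neg, zpow_natCast, ← inv_pow]
    have h := one_add_mul_le_pow (a := s⁻¹ - 1) (by have := inv_pos.2 hs; linarith) k
    have h2 : 1 - s ≤ s⁻¹ - 1 := by
      have : s⁻¹ - 1 - (1 - s) = (s - 1) ^ 2 / s := by field_simp; ring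
      have h3 : 0 ≤ (s - 1) ^ 2 / s := by positivity
      linarith
    have h4 : (k : ℝ) * (1 - s) ≤ k * (s⁻¹ - 1) := by gcongr
    have h5 : 1 + (s⁻¹ - 1) = s⁻¹ := by ring
    rw [h5] at h
    push_cast
    linarith

/-- The hypotheses make the weighted mean of `u₂ / u₁` and `u₃ / u₁` equal to 1, so averaging
Bernoulli's inequality cancels the linear terms. Thus a form vanishing at `1` and `u` is nonnegative
at every power of `u`. -/
theorem mul_zpow_le_of_eq {A₁ A₂ A₃ u₁ u₂ u₃ : ℝ} (hA₂ : 0 < A₂) (hA₃ : 0 < A₃)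
    (hu₁ : 0 < u₁) (hu₂ : 0 < u₂) (hu₃ : 0 < u₃) (h : A₁ = A₂ + A₃)
    (hu : A₁ * u₁ = A₂ * u₂ + A₃ * u₃) (m : ℤ) :
    A₁ * u₁ ^ m ≤ A₂ * u₂ ^ m + A₃ * u₃ ^ m := by
  have h2 := one_add_mul_sub_le_zpow (div_pos hu₂ hu₁) m
  have h3 := one_add_mul_sub_le_zpow (div_pos hu₃ hu₁) m
  have hp : 0 < u₁ ^ m := zpow_pos hu₁ m
  have h4 : A₂ * (1 + m * (u₂ / u₁ - 1)) + A₃ * (1 + m * (u₃ / u₁ - 1)) = A₁ := by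
    have : A₂ * (1 + m * (u₂ / u₁ - 1)) + A₃ * (1 + m * (u₃ / u₁ - 1)) =
      A₂ + A₃ + m * ((A₂ * u₂ + A₃ * u₃) / u₁ - (A₂ + A₃)) := by ring
    rw [this, ← hu, ← h]; field_simp; ring
  have h5 : A₁ ≤ A₂ * (u₂ / u₁) ^ m + A₃ * (u₃ / u₁) ^ m := by
    rw [← h4]; gcongr
  rw [div_zpow, div_zpow] at h5
  calc A₁ * u₁ ^ m ≤ (A₂ * (u₂ ^ m / u₁ ^ m) + A₃ * (u₃ ^ m / u₁ ^ m)) * u₁ ^ m := by gcongr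
    _ = _ := by field_simp

/-! ### Covering the octant by translates of a cone -/

/-- The data of two units of a totally real cubic order, given by their real conjugates `rᵢ` and
`uᵢ`, together with two linear forms `-A₁ y₁ + A₂ y₂ + A₃ y₃` and `-B₁ y₁ + B₂ y₂ - B₃ y₃`
which vanish on the edges `1, u` and `1, r` of a fundamental cone. -/
structure UnitPair (r₁ r₂ r₃ u₁ u₂ u₃ A₁ A₂ A₃ B₁ B₂ B₃ : ℝ) : Prop where
  r₁_pos : 0 < r₁
  r₁_lt₂ : r₁ < r₂
  r₁_lt₃ : r₁ < r₃
  u₃_pos : 0 < u₃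
  u₃_lt : u₃ < u₁
  u₁_lt : u₁ < u₂
  A₂_pos : 0 < A₂
  A₃_pos : 0 < A₃
  B₁_pos : 0 < B₁
  B₂_pos : 0 < B₂
  B₃_pos : 0 < B₃
  A_one : A₁ = A₂ + A₃
  A_unit : A₁ * u₁ = A₂ * u₂ + A₃ * u₃
  B_root : B₂ * r₂ = B₁ * r₁ + B₃ * r₃

namespace UnitPair

variable {r₁ r₂ r₃ u₁ u₂ u₃ A₁ A₂ A₃ B₁ B₂ B₃ : ℝ}

theorem zpow_le (h : UnitPair r₁ r₂ r₃ u₁ u₂ u₃ A₁ A₂ A₃ B₁ B₂ B₃) (m : ℤ) :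
    A₁ * u₁ ^ m ≤ A₂ * u₂ ^ m + A₃ * u₃ ^ m :=
  mul_zpow_le_of_eq h.A₂_pos h.A₃_pos (h.u₃_pos.trans h.u₃_lt)
    ((h.u₃_pos.trans h.u₃_lt).trans h.u₁_lt) h.u₃_pos h.A_one h.A_unit m

/-- Write `A`, `B` for the two forms. If `x₃ ≤ x₂`, then `A(uᵐx) = u₁ᵐ A(x) + x₃ A(uᵐ) + A₂(x₂ -
x₃)(u₂ᵐ - u₁ᵐ)`, with all terms nonnegative. Otherwise `B(rx) ≥ 0` bounds `x₂` below by a weighted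
mean of `x₁` and `x₃`, so `x₁` is the smallest and `A(uᵐx) ≥ x₁ A(uᵐ)`. -/
theorem nonneg_of_nonneg (h : UnitPair r₁ r₂ r₃ u₁ u₂ u₃ A₁ A₂ A₃ B₁ B₂ B₃)
    {x₁ x₂ x₃ : ℝ} (h₁ : 0 < x₁) (h₃ : 0 < x₃)
    (hB : B₁ * (r₁ * x₁) + B₃ * (r₃ * x₃) ≤ B₂ * (r₂ * x₂))
    (hA : A₁ * x₁ ≤ A₂ * x₂ + A₃ * x₃) (m : ℕ) :
    A₁ * (u₁ ^ m * x₁) ≤ A₂ * (u₂ ^ m * x₂) + A₃ * (u₃ ^ m * x₃) := by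
  have hz := h.zpow_le m
  simp only [zpow_natCast] at hz
  have hr := h.r₁_pos; have hB1 := h.B₁_pos; have hB3 := h.B₃_pos; have hA2 := h.A₂_pos
  have hA3 := h.A₃_pos; have hu3 := h.u₃_pos
  have hu1 := hu3.trans h.u₃_lt
  have hu2 := hu1.trans h.u₁_lt
  have hr3 := hr.trans h.r₁_lt₃
  have hBr := h.B_root
  have hA1 := h.A_one
  rcases le_or_gt x₃ x₂ with hx | hx
  · have hmono : u₁ ^ m ≤ u₂ ^ m := pow_le_pow_left₀ hu1.le h.u₁_lt.le m
    have e1 : 0 ≤ A₂ * (x₂ - x₃) * (u₂ ^ m - u₁ ^ m) :=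
      mul_nonneg (mul_nonneg hA2.le (by linarith)) (by linarith)
    have e2 : 0 ≤ x₃ * (A₂ * u₂ ^ m + A₃ * u₃ ^ m - A₁ * u₁ ^ m) :=
      mul_nonneg h₃.le (by linarith)
    have e3 : 0 ≤ u₁ ^ m * (A₂ * x₂ + A₃ * x₃ - A₁ * x₁) :=
      mul_nonneg (by positivity) (by linarith)
    subst hA1
    linarith
  · have e0 : 0 < B₃ * r₃ * (x₃ - x₂) := mul_pos (mul_pos hB3 hr3) (by linarith)
    have e1 : 0 < B₁ * r₁ * (x₂ - x₁) := by
      have : B₂ * (r₂ * x₂) = (B₁ * r₁ + B₃ * r₃) * x₂ := by rw [← hBr]; ring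
      linarith
    have hx12 : x₁ < x₂ := by
      have := (pos_iff_pos_of_mul_pos e1).1 (mul_pos hB1 hr)
      linarith
    have e2 : A₂ * (u₂ ^ m * x₁) ≤ A₂ * (u₂ ^ m * x₂) := by gcongr
    have e3 : A₃ * (u₃ ^ m * x₁) ≤ A₃ * (u₃ ^ m * x₃) := by gcongr; linarith
    have e4 : 0 ≤ x₁ * (A₂ * u₂ ^ m + A₃ * u₃ ^ m - A₁ * u₁ ^ m) :=
      mul_nonneg h₁.le (by linarith)
    linarith

/-- The counterpart for exponents going down. Here the two hypotheses force `x₂ ≤ x₃`, and `A(uᵏx)`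
is the sum of `u₁ᵏ⁻¹ A(ux)`, `x₂ A(uᵏ)` and `A₃u₃(x₃ - x₂)(u₃ᵏ⁻¹ - u₁ᵏ⁻¹)`. -/
theorem nonneg_of_nonneg_neg (h : UnitPair r₁ r₂ r₃ u₁ u₂ u₃ A₁ A₂ A₃ B₁ B₂ B₃)
    {x₁ x₂ x₃ : ℝ} (h₂ : 0 < x₂)
    (hB : B₂ * (r₂ * x₂) ≤ B₁ * (r₁ * x₁) + B₃ * (r₃ * x₃))
    (hA : A₁ * (u₁ * x₁) ≤ A₂ * (u₂ * x₂) + A₃ * (u₃ * x₃)) {k : ℤ} (hk : k ≤ 0) :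
    A₁ * (u₁ ^ k * x₁) ≤ A₂ * (u₂ ^ k * x₂) + A₃ * (u₃ ^ k * x₃) := by
  have hz := h.zpow_le k
  have hr := h.r₁_pos; have hB1 := h.B₁_pos; have hB3 := h.B₃_pos; have hA2 := h.A₂_pos
  have hA3 := h.A₃_pos; have hu3 := h.u₃_pos
  have hu1 := hu3.trans h.u₃_lt
  have hu2 := hu1.trans h.u₁_lt
  have hr3 := hr.trans h.r₁_lt₃
  have hBr := h.B_root
  have hAu := h.A_unit
  have hx : x₂ ≤ x₃ := by
    by_contra! hx
    have e0 : 0 < B₃ * r₃ * (x₂ - x₃) := mul_pos (mul_pos hB3 hr3) (by linarith)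
    have e1 : 0 < B₁ * r₁ * (x₁ - x₂) := by
      have : B₂ * (r₂ * x₂) = (B₁ * r₁ + B₃ * r₃) * x₂ := by rw [← hBr]; ring
      linarith
    have hx12 : x₂ < x₁ := by
      have := (pos_iff_pos_of_mul_pos e1).1 (mul_pos hB1 hr)
      linarith
    have e2 : A₂ * (u₂ * x₂) < A₂ * (u₂ * x₁) := by gcongr
    have e3 : A₃ * (u₃ * x₃) < A₃ * (u₃ * x₁) := by gcongr; linarith
    have e4 : A₁ * (u₁ * x₁) = (A₂ * u₂ + A₃ * u₃) * x₁ := by rw [← hAu]; ring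
    linarith
  have f : ∀ t : ℝ, 0 < t → t ^ k = t * t ^ (k - 1) := fun t ht => by
    rw [← zpow_one_add₀ ht.ne']; congr 1; ring
  have hmono : u₁ ^ (k - 1) ≤ u₃ ^ (k - 1) := by
    have := inv_anti₀ (zpow_pos hu3 (1 - k))
      (zpow_le_zpow_left₀ (n := 1 - k) (by omega) hu3.le h.u₃_lt.le)
    simpa only [← zpow_neg, neg_sub] using this
  have hp : 0 < u₁ ^ (k - 1) := zpow_pos hu1 _
  rw [f _ hu1, f _ hu2, f _ hu3] at *
  have e1 : 0 ≤ A₃ * u₃ * (x₃ - x₂) * (u₃ ^ (k - 1) - u₁ ^ (k - 1)) :=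
    mul_nonneg (mul_nonneg (mul_nonneg hA3.le hu3.le) (by linarith)) (by linarith)
  have e2 := mul_nonneg h₂.le (sub_nonneg.2 hz)
  have e3 := mul_nonneg hp.le (sub_nonneg.2 hA)
  have e4 : A₁ * (u₁ * u₁ ^ (k - 1)) * x₂ = (A₂ * u₂ + A₃ * u₃) * (u₁ ^ (k - 1) * x₂) := by
    rw [← hAu]; ring
  linarith

/-- The translates of the cone `⟨1, r, u, r u⟩` under the units `rⁿ uᵐ` cover the octant. -/
theorem exists_zpow_mem_cone (h : UnitPair r₁ r₂ r₃ u₁ u₂ u₃ A₁ A₂ A₃ B₁ B₂ B₃)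
    {x₁ x₂ x₃ : ℝ} (h₁ : 0 < x₁) (h₂ : 0 < x₂) (h₃ : 0 < x₃) :
    ∃ (n m : ℤ) (y₁ y₂ y₃ : ℝ), y₁ = r₁ ^ n * u₁ ^ m * x₁ ∧ y₂ = r₂ ^ n * u₂ ^ m * x₂ ∧
      y₃ = r₃ ^ n * u₃ ^ m * x₃ ∧
      A₁ * y₁ ≤ A₂ * y₂ + A₃ * y₃ ∧
      A₂ * (r₂⁻¹ * y₂) + A₃ * (r₃⁻¹ * y₃) ≤ A₁ * (r₁⁻¹ * y₁) ∧
      B₁ * y₁ + B₃ * y₃ ≤ B₂ * y₂ ∧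
      B₂ * (u₂⁻¹ * y₂) ≤ B₁ * (u₁⁻¹ * y₁) + B₃ * (u₃⁻¹ * y₃) := by
  have hr := h.r₁_pos; have hB1 := h.B₁_pos; have hB2 := h.B₂_pos; have hB3 := h.B₃_pos
  have hA2 := h.A₂_pos
  have hA3 := h.A₃_pos; have hu3 := h.u₃_pos
  have hu1 := hu3.trans h.u₃_lt
  have hu2 := hu1.trans h.u₁_lt
  have hr3 := hr.trans h.r₁_lt₃
  have hr2 := hr.trans h.r₁_lt₂
  have hA1 : 0 < A₁ := by rw [h.A_one]; linarith
  -- `n` is the least exponent for which the whole `u`-orbit of `rⁿx` lies in the half-space `A ≥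
  -- 0`; then `m` is the least exponent that puts `rⁿuᵐx` in `B ≥ 0`. Minimality of `m` gives the
  -- face through `u, ru`.
  obtain ⟨n, hn, hmin⟩ := Int.exists_least_of_bdd
    (P := fun n : ℤ => ∀ m : ℤ, A₁ * (r₁ ^ n * u₁ ^ m * x₁) ≤
      A₂ * (r₂ ^ n * u₂ ^ m * x₂) + A₃ * (r₃ ^ n * u₃ ^ m * x₃))
    (by
      obtain ⟨N, hN⟩ := exists_zpow_lt_zpow_neg hr h.r₁_lt₂ (C := A₁ * x₁ / 2) (A₂ * x₂)
        (by positivity)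
      obtain ⟨N', hN'⟩ := exists_zpow_lt_zpow_neg hr h.r₁_lt₃ (C := A₁ * x₁ / 2) (A₃ * x₃)
        (by positivity)
      refine ⟨min N N', fun z hz => ?_⟩
      by_contra! hlt
      have e1 := hN z (by omega)
      have e2 := hN' z (by omega)
      have := hz 0
      simp only [zpow_zero, mul_one] at this
      linarith)
    (by
      obtain ⟨N, hN⟩ := exists_zpow_lt_zpow hr h.r₁_lt₂ x₁ h₂
      obtain ⟨N', hN'⟩ := exists_zpow_lt_zpow hr h.r₁_lt₃ x₁ h₃
      refine ⟨max N N', fun m => ?_⟩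
      have e1 := hN (max N N') (le_max_left _ _)
      have e2 := hN' (max N N') (le_max_right _ _)
      set p := max N N'
      have hz := h.zpow_le m
      have p2 : 0 < u₂ ^ m := zpow_pos hu2 m
      have p3 : 0 < u₃ ^ m := zpow_pos hu3 m
      have p1 : 0 < r₁ ^ p := zpow_pos hr p
      have f1 := mul_nonneg (mul_pos h₁ p1).le (sub_nonneg.2 hz)
      have f2 := mul_pos (mul_pos hA2 p2) (sub_pos.2 e1)
      have f3 := mul_pos (mul_pos hA3 p3) (sub_pos.2 e2)
      linarith)
  have hq₁ : 0 < r₁ ^ n * x₁ := mul_pos (zpow_pos hr n) h₁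
  have hq₂ : 0 < r₂ ^ n * x₂ := mul_pos (zpow_pos hr2 n) h₂
  have hq₃ : 0 < r₃ ^ n * x₃ := mul_pos (zpow_pos hr3 n) h₃
  obtain ⟨m, hm, hmmin⟩ := Int.exists_least_of_bdd
    (P := fun m : ℤ => B₁ * (r₁ ^ n * u₁ ^ m * x₁) + B₃ * (r₃ ^ n * u₃ ^ m * x₃) ≤
      B₂ * (r₂ ^ n * u₂ ^ m * x₂))
    (by
      obtain ⟨N, hN⟩ := exists_zpow_lt_zpow_neg hu1 h.u₁_lt (C := B₁ * (r₁ ^ n * x₁))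
        (B₂ * (r₂ ^ n * x₂)) (by positivity)
      refine ⟨N, fun z hz => ?_⟩
      by_contra! hlt
      have e1 := hN z hlt.le
      have e2 : 0 < B₃ * (r₃ ^ n * u₃ ^ z * x₃) := by positivity
      linarith)
    (by
      obtain ⟨N, hN⟩ := exists_zpow_lt_zpow hu1 h.u₁_lt (B₁ * (r₁ ^ n * x₁))
        (D := B₂ * (r₂ ^ n * x₂) / 2) (by positivity)
      obtain ⟨N', hN'⟩ := exists_zpow_lt_zpow hu3 (h.u₃_lt.trans h.u₁_lt) (B₃ * (r₃ ^ n * x₃))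
        (D := B₂ * (r₂ ^ n * x₂) / 2) (by positivity)
      refine ⟨max N N', ?_⟩
      have e1 := hN (max N N') (le_max_left _ _)
      have e2 := hN' (max N N') (le_max_right _ _)
      linarith)
  have hm' : B₂ * (r₂ ^ n * u₂ ^ (m - 1) * x₂) ≤ B₁ * (r₁ ^ n * u₁ ^ (m - 1) * x₁) +
      B₃ * (r₃ ^ n * u₃ ^ (m - 1) * x₃) := by
    by_contra! hlt
    have := hmmin (m - 1) hlt.le
    omega
  refine ⟨n, m, _, _, _, rfl, rfl, rfl, hn m, ?_, hm, ?_⟩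
  · by_contra! hlt
    -- If the inequality for the face through `r, ru` failed, the orbit of `rⁿ⁻¹x` would satisfy `A
    -- ≥ 0` at exponent `m`, hence at all larger and all smaller exponents, against the minimality
    -- of `n`.
    have key : ∀ l : ℤ, A₁ * (r₁ ^ (n - 1) * u₁ ^ l * x₁) ≤
        A₂ * (r₂ ^ (n - 1) * u₂ ^ l * x₂) + A₃ * (r₃ ^ (n - 1) * u₃ ^ l * x₃) := by
      have g : ∀ t : ℝ, 0 < t → t ^ n = t * t ^ (n - 1) := fun t ht => by
        rw [← zpow_one_add₀ ht.ne']; congr 1; ring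
      have c : ∀ s t : ℝ, 0 < s → s⁻¹ * (s * s ^ (n - 1) * t) = s ^ (n - 1) * t := fun s t hs => by
        field_simp
      intro l
      have pr1 := zpow_pos hr (n - 1); have pr2 := zpow_pos hr2 (n - 1)
      have pr3 := zpow_pos hr3 (n - 1)
      simp only [g _ hr, g _ hr2, g _ hr3] at hlt hm hm'
      rcases le_total m l with hl | hl
      · obtain ⟨d, rfl⟩ := Int.le.dest hl
        have := h.nonneg_of_nonneg (x₁ := r₁ ^ (n - 1) * u₁ ^ m * x₁)
          (x₂ := r₂ ^ (n - 1) * u₂ ^ m * x₂) (x₃ := r₃ ^ (n - 1) * u₃ ^ m * x₃)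
          (by positivity) (by positivity) (by linarith) (by
            rw [mul_assoc (r₁ * _), mul_assoc (r₂ * _), mul_assoc (r₃ * _), c _ _ hr, c _ _ hr2,
              c _ _ hr3] at hlt
            linarith) d
        rw [zpow_add₀ hu1.ne', zpow_add₀ hu2.ne', zpow_add₀ hu3.ne']
        simp only [zpow_natCast]
        linarith
      · have s : ∀ t : ℝ, 0 < t → t ^ m = t * t ^ (m - 1) := fun t ht => by
          rw [← zpow_one_add₀ ht.ne']; congr 1; ring
        have s' : ∀ t : ℝ, 0 < t → t ^ l = t ^ (l - m + 1) * t ^ (m - 1) := fun t ht => by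
          rw [← zpow_add₀ ht.ne']; congr 1; ring
        have := h.nonneg_of_nonneg_neg (x₁ := r₁ ^ (n - 1) * u₁ ^ (m - 1) * x₁)
          (x₂ := r₂ ^ (n - 1) * u₂ ^ (m - 1) * x₂) (x₃ := r₃ ^ (n - 1) * u₃ ^ (m - 1) * x₃)
          (by positivity) (by linarith) (by
            rw [mul_assoc (r₁ * _), mul_assoc (r₂ * _), mul_assoc (r₃ * _), c _ _ hr, c _ _ hr2,
              c _ _ hr3, s _ hu1, s _ hu2, s _ hu3] at hlt
            linarith) (k := l - m + 1)
        by_cases hlm : l = m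
        · subst hlm
          rw [mul_assoc (r₁ * _), mul_assoc (r₂ * _), mul_assoc (r₃ * _), c _ _ hr, c _ _ hr2,
              c _ _ hr3] at hlt
          linarith
        · have := this (by omega)
          rw [s' _ hu1, s' _ hu2, s' _ hu3]
          linarith
    have := hmin (n - 1) key
    omega
  · have s : ∀ t : ℝ, 0 < t → t ^ (m - 1) = t⁻¹ * t ^ m := fun t ht => by
      rw [← zpow_neg_one, ← zpow_add₀ ht.ne']; congr 1; ring
    rw [s _ hu1, s _ hu2, s _ hu3] at hm'
    linarith

end UnitPair

/-! ### Real roots and linear forms in coordinates -/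

/-- `r₁ < r₂ < r₃` are the roots of `x (x - a) (x - b) = 1`, localized. -/
structure OrderedRoots (a b r₁ r₂ r₃ : ℝ) : Prop where
  r₁_pos : 0 < r₁
  r₁_lt : r₁ < 1
  lt_r₂ : a - 1 < r₂
  r₂_lt : r₂ < a
  lt_r₃ : b < r₃
  eq₁ : r₁ * (r₁ - a) * (r₁ - b) = 1
  eq₂ : r₂ * (r₂ - a) * (r₂ - b) = 1
  eq₃ : r₃ * (r₃ - a) * (r₃ - b) = 1
  sum_eq : r₁ + r₂ + r₃ = a + b

theorem exists_orderedRoots {a b : ℝ} (ha : 2 ≤ a) (hab : a ≤ b - 2) :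
    ∃ r₁ r₂ r₃, OrderedRoots a b r₁ r₂ r₃ := by
  have hc : Continuous fun t : ℝ => t * (t - a) * (t - b) := by fun_prop
  have h1 : (1 : ℝ) ∈ Set.Ioo ((0 : ℝ) * (0 - a) * (0 - b)) (1 * (1 - a) * (1 - b)) :=
    ⟨by norm_num, by nlinarith⟩
  have h2 : (1 : ℝ) ∈ Set.Ioo (a * (a - a) * (a - b)) ((a - 1) * (a - 1 - a) * (a - 1 - b)) :=
    ⟨by norm_num, by nlinarith⟩
  have h3 : (1 : ℝ) ∈ Set.Ioo (b * (b - a) * (b - b)) ((b + 1) * (b + 1 - a) * (b + 1 - b)) :=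
    ⟨by norm_num, by nlinarith⟩
  obtain ⟨r₁, ⟨h11, h12⟩, e1⟩ := intermediate_value_Ioo (by norm_num) hc.continuousOn h1
  obtain ⟨r₂, ⟨h21, h22⟩, e2⟩ := intermediate_value_Ioo' (by linarith) hc.continuousOn h2
  obtain ⟨r₃, ⟨h31, h32⟩, e3⟩ := intermediate_value_Ioo (by linarith) hc.continuousOn h3
  simp only at e1 e2 e3
  refine ⟨r₁, r₂, r₃, h11, h12, h21, h22, h31, e1, e2, e3, ?_⟩
  -- The second divided difference of the cubic at the three points vanishes, since its values there
  -- agree.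
  have d : (r₂ - r₁) * (r₃ - r₁) * (r₃ - r₂) * (r₁ + r₂ + r₃ - (a + b)) = 0 := by
    linear_combination (r₃ - r₂) * e1 - (r₃ - r₁) * e2 + (r₂ - r₁) * e3
  have hV : (r₂ - r₁) * (r₃ - r₁) * (r₃ - r₂) ≠ 0 := by
    refine mul_ne_zero (mul_ne_zero ?_ ?_) ?_ <;> intro h <;> linarith
  linarith [(mul_eq_zero.1 d).resolve_left hV]

namespace OrderedRoots

variable {a b r₁ r₂ r₃ : ℝ}

theorem unitPair (h : OrderedRoots a b r₁ r₂ r₃) (ha : 2 ≤ a) (hab : a ≤ b - 2) :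
    UnitPair r₁ r₂ r₃ (r₁ * (r₁ - b) ^ 2) (r₂ * (r₂ - b) ^ 2) (r₃ * (r₃ - b) ^ 2)
      ((a - r₁) * (r₃ - r₂)) ((a - r₂) * (r₃ - r₁)) ((r₃ - a) * (r₂ - r₁))
      (r₃ - r₂) (r₃ - r₁) (r₂ - r₁) := by
  obtain ⟨h1, h2, h3, h4, h5, e1, e2, e3, hs⟩ := h
  have u1 : r₁ * (r₁ - b) ^ 2 = 1 + (b - a) * (r₁ * (b - r₁)) := by linear_combination e1
  have u2 : r₂ * (r₂ - b) ^ 2 = 1 + (b - a) * (r₂ * (b - r₂)) := by linear_combination e2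
  have u3 : r₃ * (r₃ - b) ^ 2 = 1 + (b - a) * (r₃ * (b - r₃)) := by linear_combination e3
  have c1 : 0 < r₁ * (b - r₁) := mul_pos h1 (by linarith)
  have c3 : 0 < r₃ * (r₃ - b) := mul_pos (by linarith) (by linarith)
  refine ⟨h1, by linarith, by linarith, ?_, ?_, ?_, ?_, ?_, by linarith, by linarith, by linarith,
    by ring, ?_, by ring⟩
  · have : 0 < r₃ - b := by linarith
    have : 0 < r₃ := by linarith
    positivity
  · rw [u1, u3]
    have : (b - a) * (r₃ * (b - r₃)) < (b - a) * (r₁ * (b - r₁)) := by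
      apply mul_lt_mul_of_pos_left _ (by linarith)
      linarith
    linarith
  · rw [u1, u2]
    -- At a root, `r(b - r) = 1 / (a - r)`, which increases for `r < a`.
    have : r₁ * (b - r₁) < r₂ * (b - r₂) := by
      have f1 : (a - r₁) * (r₁ * (b - r₁)) = 1 := by linear_combination e1
      have f2 : (a - r₂) * (r₂ * (b - r₂)) = 1 := by linear_combination e2
      by_contra! hle
      have f3 : (a - r₂) * (r₂ * (b - r₂)) ≤ (a - r₂) * (r₁ * (b - r₁)) :=
        mul_le_mul_of_nonneg_left hle (by linarith)
      have f4 : (a - r₂) * (r₁ * (b - r₁)) < (a - r₁) * (r₁ * (b - r₁)) :=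
        mul_lt_mul_of_pos_right (by linarith) c1
      linarith
    have := mul_lt_mul_of_pos_left this (show 0 < b - a by linarith)
    linarith
  · exact mul_pos (by linarith) (by linarith)
  · exact mul_pos (by linarith) (by linarith)
  · rw [u1, u2, u3]
    linear_combination (b - a) * ((r₃ - r₂) * e1 - (r₃ - r₁) * e2 + (r₂ - r₁) * e3)

theorem vandermonde_pos (h : OrderedRoots a b r₁ r₂ r₃) (ha : 2 ≤ a) (hab : a ≤ b - 2) :
    0 < (r₂ - r₁) * (r₃ - r₁) * (r₃ - r₂) := by
  obtain ⟨h1, h2, h3, h4, h5, -⟩ := h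
  exact mul_pos (mul_pos (by linarith) (by linarith)) (by linarith)

/-- The first linear form of `OrderedRoots.unitPair` in terms of the coefficients. -/
theorem form_eq (h : OrderedRoots a b r₁ r₂ r₃) (x y z : ℝ) :
    -((a - r₁) * (r₃ - r₂)) * (x + y * r₁ + z * r₁ ^ 2) +
      (a - r₂) * (r₃ - r₁) * (x + y * r₂ + z * r₂ ^ 2) +
      (r₃ - a) * (r₂ - r₁) * (x + y * r₃ + z * r₃ ^ 2) =
    (r₂ - r₁) * (r₃ - r₁) * (r₃ - r₂) * (y + b * z) := by
  linear_combination ((r₂ - r₁) * (r₃ - r₁) * (r₃ - r₂)) * z * h.sum_eq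

/-- By `form_eq`, the `k`-coordinate after division by `ρ` is `-(ax + w)`; this is where the face
through `ρ, ρu` gets its equation. -/
theorem inv_eq {a b r : ℝ} (h : r * (r - a) * (r - b) = 1) (x k w : ℝ) :
    r⁻¹ * (x + k * r + w * (r * (b - r))) =
      (x * (a * b) + k + w * b) + (-(x * (a + b)) - w) * r + x * r ^ 2 := by
  have hr : r ≠ 0 := by rintro rfl; norm_num at h
  rw [inv_mul_eq_iff_eq_mul₀ hr]
  linear_combination -x * h

theorem unit_inv_eq {a b r : ℝ} (h : r * (r - a) * (r - b) = 1) (x k w : ℝ) :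
    (r * (r - b) ^ 2)⁻¹ * (x + k * r + w * (r * (b - r))) =
      (x + k * (b - a)) + (-x * (b - a) * a + k * (1 - a * b * (b - a)) + w * a) * r +
        (x * (b - a) + k * ((b - a) * b) - w) * r ^ 2 := by
  have h1 : r * (r - b) ^ 2 * (r * (r - a) ^ 2) = 1 := by
    linear_combination (r * (r - a) * (r - b) + 1) * h
  have h2 : (r * (r - b) ^ 2)⁻¹ = r * (r - a) ^ 2 := inv_eq_of_mul_eq_one_right h1
  rw [h2]
  linear_combination (x + k * r + k * (b - a) - w * r * (r - a)) * h

/-- Total positivity forces two linear inequalities on the coordinates. -/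
theorem coord_pos (h : OrderedRoots a b r₁ r₂ r₃) (ha : 2 ≤ a) (hab : a ≤ b - 2) {x k w : ℝ}
    (h₁ : 0 < x + k * r₁ + w * (r₁ * (b - r₁))) (h₂ : 0 < x + k * r₂ + w * (r₂ * (b - r₂)))
    (h₃ : 0 < x + k * r₃ + w * (r₃ * (b - r₃))) :
    0 < k + r₁ * (a * x + w) ∧ 0 < k + r₂ * (a * x + w) := by
  have hV := h.vandermonde_pos ha hab
  have hf := h.form_eq (x * (a * b) + k + w * b) (-(x * (a + b)) - w) x
  have hg := h.form_eq x (k + w * b) (-w)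
  obtain ⟨p1, p2, p3, p4, p5, e1, e2, e3, hs⟩ := h
  have y1 := mul_pos (inv_pos.2 p1) h₁
  have y2 := mul_pos (inv_pos.2 (show 0 < r₂ by linarith)) h₂
  have y3 := mul_pos (inv_pos.2 (show 0 < r₃ by linarith)) h₃
  have z1 : r₁ * (r₁⁻¹ * (x + k * r₁ + w * (r₁ * (b - r₁)))) =
      x + (k + w * b) * r₁ + -w * r₁ ^ 2 := by field_simp; ring
  have z2 : r₂ * (r₂⁻¹ * (x + k * r₂ + w * (r₂ * (b - r₂)))) =
      x + (k + w * b) * r₂ + -w * r₂ ^ 2 := by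
    have : r₂ ≠ 0 := by linarith
    field_simp; ring
  have z3 : r₃ * (r₃⁻¹ * (x + k * r₃ + w * (r₃ * (b - r₃)))) =
      x + (k + w * b) * r₃ + -w * r₃ ^ 2 := by
    have : r₃ ≠ 0 := by linarith
    field_simp; ring
  rw [inv_eq e1] at y1 z1
  rw [inv_eq e2] at y2 z2
  rw [inv_eq e3] at y3 z3
  rw [← z1, ← z2, ← z3] at hg
  set Y1 := (x * (a * b) + k + w * b) + (-(x * (a + b)) - w) * r₁ + x * r₁ ^ 2
  set Y2 := (x * (a * b) + k + w * b) + (-(x * (a + b)) - w) * r₂ + x * r₂ ^ 2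
  set Y3 := (x * (a * b) + k + w * b) + (-(x * (a + b)) - w) * r₃ + x * r₃ ^ 2
  have q1 : 0 < (a - r₁) * (r₃ - r₂) := mul_pos (by linarith) (by linarith)
  have q2 : 0 < (a - r₂) * (r₃ - r₁) := mul_pos (by linarith) (by linarith)
  have q3 : 0 < (r₃ - a) * (r₂ - r₁) := mul_pos (by linarith) (by linarith)
  constructor
  · refine pos_of_mul_pos_right (b := _) (a := (r₂ - r₁) * (r₃ - r₁) * (r₃ - r₂)) ?_ hV.le
    -- With `Y = ρ⁻¹y`, this is the first form at `(ρ - r₁)Y`: the term in `Y1` drops out and the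
    -- other two coefficients are positive. The factor `ρ - r₂` works likewise below.
    have : (r₂ - r₁) * (r₃ - r₁) * (r₃ - r₂) * (k + r₁ * (a * x + w)) =
      (a - r₂) * (r₃ - r₁) * Y2 * (r₂ - r₁) + (r₃ - a) * (r₂ - r₁) * Y3 * (r₃ - r₁) := by
      linear_combination r₁ * hf - hg
    rw [this]
    have d1 := mul_pos (mul_pos q2 y2) (show 0 < r₂ - r₁ by linarith)
    have d2 := mul_pos (mul_pos q3 y3) (show 0 < r₃ - r₁ by linarith)
    linarith
  · refine pos_of_mul_pos_right (b := _) (a := (r₂ - r₁) * (r₃ - r₁) * (r₃ - r₂)) ?_ hV.le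
    have : (r₂ - r₁) * (r₃ - r₁) * (r₃ - r₂) * (k + r₂ * (a * x + w)) =
      (a - r₁) * (r₃ - r₂) * Y1 * (r₂ - r₁) + (r₃ - a) * (r₂ - r₁) * Y3 * (r₃ - r₂) := by
      linear_combination r₂ * hf - hg
    rw [this]
    have d1 := mul_pos (mul_pos q1 y1) (show 0 < r₂ - r₁ by linarith)
    have d2 := mul_pos (mul_pos q3 y3) (show 0 < r₃ - r₂ by linarith)
    linarith

/-- The coordinates of a vector in the fundamental cone satisfy linear inequalities. -/
theorem coord_cone (h : OrderedRoots a b r₁ r₂ r₃) (ha : 2 ≤ a) (hab : a ≤ b - 2)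
    {x k w y₁ y₂ y₃ : ℝ} (h₁ : y₁ = x + k * r₁ + w * (r₁ * (b - r₁)))
    (h₂ : y₂ = x + k * r₂ + w * (r₂ * (b - r₂))) (h₃ : y₃ = x + k * r₃ + w * (r₃ * (b - r₃)))
    (i₁ : (a - r₁) * (r₃ - r₂) * y₁ ≤ (a - r₂) * (r₃ - r₁) * y₂ + (r₃ - a) * (r₂ - r₁) * y₃)
    (i₂ : (a - r₂) * (r₃ - r₁) * (r₂⁻¹ * y₂) + (r₃ - a) * (r₂ - r₁) * (r₃⁻¹ * y₃) ≤
      (a - r₁) * (r₃ - r₂) * (r₁⁻¹ * y₁))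
    (i₃ : (r₃ - r₂) * y₁ + (r₂ - r₁) * y₃ ≤ (r₃ - r₁) * y₂)
    (i₄ : (r₃ - r₁) * ((r₂ * (r₂ - b) ^ 2)⁻¹ * y₂) ≤
      (r₃ - r₂) * ((r₁ * (r₁ - b) ^ 2)⁻¹ * y₁) + (r₂ - r₁) * ((r₃ * (r₃ - b) ^ 2)⁻¹ * y₃)) :
    0 ≤ k ∧ 0 ≤ w ∧ 0 ≤ a * x + w ∧ w ≤ (b - a) * (x + b * k) := by
  have hV := h.vandermonde_pos ha hab
  have hf := h.form_eq (x * (a * b) + k + w * b) (-(x * (a + b)) - w) x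
  have hg := h.form_eq x (k + w * b) (-w)
  subst h₁ h₂ h₃
  rw [inv_eq h.eq₁, inv_eq h.eq₂, inv_eq h.eq₃] at i₂
  rw [unit_inv_eq h.eq₁, unit_inv_eq h.eq₂, unit_inv_eq h.eq₃] at i₄
  refine ⟨?_, ?_, ?_, ?_⟩
  · refine le_of_mul_le_mul_left ?_ hV
    linarith
  · refine le_of_mul_le_mul_left ?_ hV
    linarith
  · refine le_of_mul_le_mul_left ?_ hV
    linarith
  · refine le_of_mul_le_mul_left ?_ hV
    linarith

/-- No totally positive element with first coordinate form `k ≤ 0` is a summand of an element with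
`k = 1` and `0 ≤ a x + w ≤ a - 1`. -/
theorem false_of_add (h : OrderedRoots a b r₁ r₂ r₃) {A x k w x' k' w' : ℤ}
    (hA : (A : ℝ) = a) (ha : 2 ≤ a) (hab : a ≤ b - 2)
    (h₁ : 0 < x + k * r₁ + w * (r₁ * (b - r₁))) (h₂ : 0 < x + k * r₂ + w * (r₂ * (b - r₂)))
    (h₃ : 0 < x + k * r₃ + w * (r₃ * (b - r₃)))
    (h₁' : 0 < x' + k' * r₁ + w' * (r₁ * (b - r₁)))
    (h₂' : 0 < x' + k' * r₂ + w' * (r₂ * (b - r₂)))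
    (h₃' : 0 < x' + k' * r₃ + w' * (r₃ * (b - r₃)))
    (hk : k ≤ 0) (hkk : k + k' = 1) (hle : A * (x + x') + (w + w') ≤ A - 1) : False := by
  obtain ⟨c1, c2⟩ := h.coord_pos ha hab h₁ h₂ h₃
  obtain ⟨-, c4⟩ := h.coord_pos ha hab h₁' h₂' h₃'
  obtain ⟨p1, p2, p3, p4, p5, e1, e2, e3, hs⟩ := h
  have hA2 : 2 ≤ A := by exact_mod_cast hA ▸ ha
  have hleR : (a : ℝ) * (x + x') + (w + w') ≤ a - 1 := by rw [← hA]; exact_mod_cast hle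
  have hkkR : (k : ℝ) + k' = 1 := by exact_mod_cast hkk
  -- With `ψ = ax + w`: if `k = 0`, then `1 ≤ ψ ≤ a - 1`, and positivity at `r₂` and `r₃` is
  -- contradictory. If `k < 0`, the bound at `r₁` makes `ψ` so large that the other summand violates
  -- its bound at `r₂`.
  rcases hk.eq_or_lt with rfl | hk
  · have hk' : k' = 1 := by omega
    subst hk'
    have hψ : 0 < A * x + w := by
      have : 0 < r₂ * (a * x + w) := by simpa using c2
      have := pos_of_mul_pos_right this (by linarith)
      rw [← hA] at this
      exact_mod_cast this
    have hψ' : 0 ≤ A * x' + w' := by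
      by_contra! hneg
      have h1 : (A : ℝ) * x' + w' ≤ -1 := by exact_mod_cast (show A * x' + w' ≤ -1 by omega)
      rw [hA] at h1
      have : r₂ * (a * x' + w') ≤ r₂ * (-1) := mul_le_mul_of_nonneg_left h1 (by linarith)
      push_cast at c4
      linarith
    have hw : A * x + w ≤ A - 1 := by linarith
    have hc2 : 2 ≤ r₂ * (b - r₂) := by nlinarith
    have hc3 : r₃ * (b - r₃) < 0 := mul_neg_of_pos_of_neg (by linarith) (by linarith)
    simp only [Int.cast_zero, zero_mul, add_zero] at h₂ h₃
    rcases le_or_gt x 0 with hx | hx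
    · have hxR : (x : ℝ) ≤ 0 := by exact_mod_cast hx
      have hw0 : (w : ℝ) < 0 := by
        by_contra! hw0
        have := mul_nonneg hw0 (neg_nonneg.2 hc3.le)
        linarith
      have := mul_neg_of_neg_of_pos hw0 (show 0 < r₂ * (b - r₂) by linarith)
      linarith
    · have hw2 : w ≤ -1 - A * (x - 1) := by linarith
      have hx1 : 2 * (x - 1) ≤ A * (x - 1) := mul_le_mul_of_nonneg_right hA2 (by omega)
      have hw3 : w ≤ -1 - 2 * (x - 1) := by linarith
      have hw4 : (w : ℝ) ≤ -1 - 2 * (x - 1) := by exact_mod_cast hw3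
      have hx0 : (1 : ℝ) ≤ x := by exact_mod_cast hx
      have : (w : ℝ) * (r₂ * (b - r₂)) ≤ w * 2 := by
        apply mul_le_mul_of_nonpos_left hc2
        linarith
      linarith
  · have hkR : (k : ℝ) ≤ -1 := by exact_mod_cast (show k ≤ -1 by omega)
    set ψ : ℝ := a * x + w with hψ
    have h5 : r₁ * ((a - 1) * (b - 1)) ≤ 1 := by
      have : (a - 1) * (b - 1) ≤ (a - r₁) * (b - r₁) := by
        apply mul_le_mul <;> linarith
      calc r₁ * ((a - 1) * (b - 1)) ≤ r₁ * ((a - r₁) * (b - r₁)) :=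
            mul_le_mul_of_nonneg_left this p1.le
        _ = 1 := by linear_combination e1
    have h6 : -k * ((a - 1) * (b - 1)) < ψ := by
      by_contra! hcon
      have g1 := mul_le_mul_of_nonneg_left hcon p1.le
      have g2 : -(k : ℝ) * (r₁ * ((a - 1) * (b - 1))) ≤ -k * 1 :=
        mul_le_mul_of_nonneg_left h5 (by linarith)
      linarith
    have h7 : 0 < k' + r₂ * ((a - 1) - ψ) := by
      have : r₂ * (a * x' + w') ≤ r₂ * ((a - 1) - ψ) :=
        mul_le_mul_of_nonneg_left (by linarith) (by linarith)
      linarith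
    have h8 : 1 * ((a - 1) * (-k * (b - 1) - 1)) ≤ r₂ * (ψ - (a - 1)) := by
      apply mul_le_mul <;> try linarith
      exact mul_nonneg (by linarith) (by nlinarith)
    have h9 : 1 * (-k * (b - 1) - 1) ≤ (a - 1) * (-k * (b - 1) - 1) :=
      mul_le_mul_of_nonneg_right (by linarith) (by nlinarith)
    have h10 : -(k : ℝ) * 3 ≤ -k * (b - 1) := mul_le_mul_of_nonneg_left (by linarith) (by linarith)
    linarith

end OrderedRoots

/-! ### Lattice points of the fundamental cone -/

/-- Lattice points of the cone `⟨1, ρ, u, ρ u⟩` in the coordinates `x + k ρ + w ρ (b - ρ)`. -/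
structure InCone (a b x k w : ℤ) : Prop where
  k_nonneg : 0 ≤ k
  w_nonneg : 0 ≤ w
  psi_nonneg : 0 ≤ a * x + w
  le : w ≤ (b - a) * (x + b * k)

theorem root_pos {a b r : ℝ} (ha : 2 ≤ a) (hab : a ≤ b - 2) (h : r * (r - a) * (r - b) = 1) :
    0 < r := by
  by_contra! hr
  have := mul_nonneg_of_nonpos_of_nonpos (show r - a ≤ 0 by linarith) (show r - b ≤ 0 by linarith)
  have := mul_nonpos_of_nonpos_of_nonneg hr this
  linarith

/-- The plane `w = k a (b - a)` through `1` and `ρu` cuts the cone into the simplicial cones `1, ρ,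
ρu` and `1, u, ρu`; on each side the point is a nonnegative combination of three positive numbers.
-/
theorem InCone.pos {a b x k w : ℤ} (h : InCone a b x k w) (ha : 2 ≤ a) (hab : a ≤ b - 2)
    (h0 : ¬ (x = 0 ∧ k = 0 ∧ w = 0)) {r : ℝ} (hr : r * (r - a) * (r - b) = 1) :
    0 < x + k * r + w * (r * (b - r)) := by
  have haR : (2 : ℝ) ≤ a := by exact_mod_cast ha
  have habR : (a : ℝ) ≤ b - 2 := by exact_mod_cast hab
  have rpos := root_pos haR habR hr
  obtain ⟨h1, h2, h3, h4⟩ := h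
  have h1R : (0 : ℝ) ≤ k := by exact_mod_cast h1
  have h2R : (0 : ℝ) ≤ w := by exact_mod_cast h2
  have h3R : (0 : ℝ) ≤ a * x + w := by exact_mod_cast h3
  have h4R : (w : ℝ) ≤ (b - a) * (x + b * k) := by exact_mod_cast h4
  have upos : 0 < r * (r - b) ^ 2 := by
    have : r - b ≠ 0 := by rintro h; rw [h] at hr; norm_num at hr
    positivity
  have hba : (0 : ℝ) < b - a := by linarith
  rcases le_or_gt w (k * (a * (b - a))) with hw | hw
  · have hwR : (w : ℝ) ≤ k * (a * (b - a)) := by exact_mod_cast hw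
    refine pos_of_mul_pos_right (a := (a : ℝ) * (b - a)) ?_ (by positivity)
    have e : (a : ℝ) * (b - a) * (x + k * r + w * (r * (b - r))) = (b - a) * (a * x + w) +
        (k * (a * (b - a)) - w) * r + w * (r * (r * (r - b) ^ 2)) := by
      linear_combination (w * (b - a) - w * r) * hr
    rw [e]
    have t1 : 0 ≤ ((b : ℝ) - a) * (a * x + w) := by positivity
    have t2 : 0 ≤ (k * (a * ((b : ℝ) - a)) - w) * r := mul_nonneg (by linarith) rpos.le
    have t3 : 0 ≤ (w : ℝ) * (r * (r * (r - b) ^ 2)) := by positivity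
    rcases h2.eq_or_lt with hw0 | hw0
    · subst hw0
      rcases h1.eq_or_lt with hk0 | hk0
      · subst hk0
        have hx : x ≠ 0 := fun hx => h0 ⟨hx, rfl, rfl⟩
        have : 0 < a * x := lt_of_le_of_ne (by linarith)
          (mul_ne_zero (by omega) hx).symm
        have : (0 : ℝ) < a * x := by exact_mod_cast this
        have := mul_pos hba this
        simp only [Int.cast_zero, add_zero] at t1 t2 t3 ⊢
        linarith
      · have hkR : (0 : ℝ) < k := by exact_mod_cast hk0
        have : 0 < (k * (a * ((b : ℝ) - a))) * r := by positivity
        simp only [Int.cast_zero, add_zero, sub_zero] at t1 t2 t3 ⊢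
        linarith
    · have hwR : (0 : ℝ) < w := by exact_mod_cast hw0
      have : 0 < (w : ℝ) * (r * (r * (r - b) ^ 2)) := by positivity
      linarith
  · have hwR : k * (a * ((b : ℝ) - a)) < w := by exact_mod_cast hw
    refine pos_of_mul_pos_right (a := ((b : ℝ) - a)) ?_ hba.le
    have e : ((b : ℝ) - a) * (x + k * r + w * (r * (b - r))) = ((b - a) * (x + b * k) - w) +
        (w - k * (a * (b - a))) * (r * (r - b) ^ 2) +
          k * (b - a) * (r * (r * (r - b) ^ 2)) := by
      linear_combination (-w + k * (a * (b - a)) - k * (b - a) * r + k * (b - a) ^ 2) * hr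
    rw [e]
    have t1 : 0 ≤ (k : ℝ) * (b - a) * (r * (r * (r - b) ^ 2)) := by positivity
    have t2 := mul_pos (sub_pos.2 hwR) upos
    linarith

/-- Every lattice point of the cone is one of the listed ones or splits in the cone. -/
theorem InCone.cases {a b x k w : ℤ} (h : InCone a b x k w) (ha : 2 ≤ a) (hab : a ≤ b - 2)
    (h0 : ¬ (x = 0 ∧ k = 0 ∧ w = 0)) :
    (x = 1 ∧ k = 0 ∧ 0 ≤ w ∧ w ≤ b - a) ∨
    (k = 1 ∧ 0 ≤ -x ∧ -x ≤ b - a - 1 ∧ -x * a ≤ w ∧ w ≤ (-x + 1) * a - 1) ∨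
    (x = -(b - a) ∧ k = 1 ∧ w = a * (b - a)) ∨
    ∃ x' k' w', InCone a b x' k' w' ∧ ¬ (x' = 0 ∧ k' = 0 ∧ w' = 0) ∧
      InCone a b (x - x') (k - k') (w - w') ∧ ¬ (x - x' = 0 ∧ k - k' = 0 ∧ w - w' = 0) := by
  obtain ⟨h1, h2, h3, h4⟩ := h
  have hba : 0 < b - a := by omega
  rcases h1.eq_or_lt with rfl | hk
  · simp only [mul_zero, add_zero] at h4
    have hx : 1 ≤ x := by
      by_contra! hx
      rcases (show x ≤ 0 by omega).eq_or_lt with rfl | hx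
      · exact h0 ⟨rfl, rfl, by linarith⟩
      · nlinarith
    rcases hx.eq_or_lt with rfl | hx
    · exact Or.inl ⟨rfl, rfl, h2, by linarith⟩
    -- On the face `k = 0`, a point of height `x ≥ 2` loses a point of height 1, with its `w` capped
    -- at that of `u`.
    · refine Or.inr (Or.inr (Or.inr ⟨1, 0, min w (b - a), ⟨le_rfl, by omega, by omega, ?_⟩,
        by omega, ⟨by omega, by omega, ?_, ?_⟩, by omega⟩))
      · simp
      · have := mul_nonneg (show 0 ≤ a by omega) (show 0 ≤ x - 1 by omega)
        omega
      · simp only [sub_zero, mul_zero, add_zero]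
        have := mul_nonneg hba.le (show 0 ≤ x - 1 by omega)
        have e : (b - a) * x = (b - a) * (x - 1) + (b - a) := by ring
        omega
  · rcases le_or_gt (a * (b - a)) w with hw | hw
    · by_cases hρu : x = -(b - a) ∧ k = 1 ∧ w = a * (b - a)
      · exact Or.inr (Or.inr (Or.inl hρu))
      -- Split off `ρu`; the next two splittings remove `1` (when `ax + w ≥ a`) and `ρ` (when `k ≥
      -- 2`).
      · refine Or.inr (Or.inr (Or.inr ⟨-(b - a), 1, a * (b - a), ⟨by omega, by nlinarith,
          by linarith, by linarith⟩, by omega, ⟨by omega, by omega, by linarith, by linarith⟩,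
          by omega⟩))
    · rcases le_or_gt a (a * x + w) with hx | hx
      · have hwk : w * b ≤ (b - a) * (a * b * k) := by
          have : a * (b - a) * 1 ≤ a * (b - a) * k :=
            mul_le_mul_of_nonneg_left hk (mul_nonneg (by omega) hba.le)
          have := mul_le_mul_of_nonneg_right (show w ≤ a * (b - a) * k by linarith)
            (show 0 ≤ b by omega)
          linarith
        refine Or.inr (Or.inr (Or.inr ⟨1, 0, 0, ⟨le_rfl, le_rfl, by omega, by linarith⟩,
          by omega, ⟨by omega, by omega, by linarith, ?_⟩, by omega⟩))
        simp only [sub_zero]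
        have := mul_le_mul_of_nonneg_left hx hba.le
        refine le_of_mul_le_mul_left ?_ (show 0 < a by omega)
        linarith
      · rcases (show 1 ≤ k from hk).eq_or_lt with rfl | hk
        · refine Or.inr (Or.inl ⟨rfl, ?_, ?_, by linarith, by linarith⟩)
          · have : a * x < a * 1 := by linarith
            have := lt_of_mul_lt_mul_left this (by omega)
            omega
          · have : a * (-x) < a * (b - a) := by linarith
            have := lt_of_mul_lt_mul_left this (by omega)
            omega
        · have hwk : w * b ≤ (b - a) * (a * b * (k - 1)) := by
            have : a * (b - a) * 1 ≤ a * (b - a) * (k - 1) :=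
              mul_le_mul_of_nonneg_left (by omega) (mul_nonneg (by omega) hba.le)
            have := mul_le_mul_of_nonneg_right (show w ≤ a * (b - a) * (k - 1) by linarith)
              (show 0 ≤ b by omega)
            linarith
          refine Or.inr (Or.inr (Or.inr ⟨0, 1, 0, ⟨by omega, le_rfl, by omega, ?_⟩,
            by omega, ⟨by omega, by omega, by linarith, ?_⟩, by omega⟩))
          · have := mul_nonneg hba.le (show 0 ≤ b by omega)
            linarith
          · simp only [sub_zero]
            have := mul_nonneg hba.le h3
            -- Multiplied by `a`, the last face inequality is the sum of `hwk` and `(b - a)(ax + w)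
            -- ≥ 0`.
            refine le_of_mul_le_mul_left ?_ (show 0 < a by omega)
            linarith

/-! ### Totally positive units of an order -/

theorem totallyPositive_mul {K : Type*} [Field K] {x y : K} (hx : TotallyPositive x)
    (hy : TotallyPositive y) : TotallyPositive (x * y) := fun σ => by
  rw [map_mul]; exact mul_pos (hx σ) (hy σ)

theorem totallyPositive_inv {K : Type*} [Field K] {x : K} (hx : TotallyPositive x) :
    TotallyPositive x⁻¹ := fun σ => by
  rw [map_inv₀]; exact inv_pos.2 (hx σ)

/-- `e` is a totally positive unit of the order `O`. -/
def IsTotallyPositiveUnit {K : Type*} [Field K] (O : Subalgebra ℤ K) (e : K) : Prop :=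
  e ≠ 0 ∧ e ∈ O ∧ e⁻¹ ∈ O ∧ TotallyPositive e

namespace IsTotallyPositiveUnit

variable {K : Type*} [Field K] {O : Subalgebra ℤ K} {e f : K}

theorem mul (he : IsTotallyPositiveUnit O e) (hf : IsTotallyPositiveUnit O f) :
    IsTotallyPositiveUnit O (e * f) :=
  ⟨mul_ne_zero he.1 hf.1, O.mul_mem he.2.1 hf.2.1, by
    rw [mul_inv]; exact O.mul_mem he.2.2.1 hf.2.2.1, totallyPositive_mul he.2.2.2 hf.2.2.2⟩

theorem inv (he : IsTotallyPositiveUnit O e) : IsTotallyPositiveUnit O e⁻¹ :=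
  ⟨inv_ne_zero he.1, he.2.2.1, by rw [inv_inv]; exact he.2.1, totallyPositive_inv he.2.2.2⟩

theorem one : IsTotallyPositiveUnit O (1 : K) :=
  ⟨one_ne_zero, O.one_mem, by simp, fun σ => by simp⟩

theorem pow (he : IsTotallyPositiveUnit O e) (n : ℕ) : IsTotallyPositiveUnit O (e ^ n) := by
  induction n with
  | zero => simpa using one
  | succ n ih => rw [pow_succ]; exact ih.mul he

theorem zpow (he : IsTotallyPositiveUnit O e) (n : ℤ) : IsTotallyPositiveUnit O (e ^ n) := by
  obtain ⟨k, rfl | rfl⟩ := n.eq_nat_or_neg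
  · rw [zpow_natCast]; exact he.pow k
  · rw [zpow_neg, zpow_natCast]; exact (he.pow k).inv

theorem of_mul_eq_one (he : e ∈ O) (hf : f ∈ O) (h : e * f = 1) (hp : TotallyPositive e) :
    IsTotallyPositiveUnit O e :=
  ⟨left_ne_zero_of_mul_eq_one h, he, by rwa [inv_eq_of_mul_eq_one_right h], hp⟩

theorem exists_unit (he : IsTotallyPositiveUnit O e) :
    ∃ ε : Oˣ, TotallyPositive ((ε : O) : K) ∧ ((ε : O) : K) = e :=
  ⟨⟨⟨e, he.2.1⟩, ⟨e⁻¹, he.2.2.1⟩, Subtype.ext (mul_inv_cancel₀ he.1),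
    Subtype.ext (inv_mul_cancel₀ he.1)⟩, he.2.2.2, rfl⟩

theorem of_unit (ε : Oˣ) (h : TotallyPositive ((ε : O) : K)) :
    IsTotallyPositiveUnit O ((ε : O) : K) :=
  of_mul_eq_one (ε : O).2 ((ε⁻¹ : Oˣ) : O).2 (by exact_mod_cast congrArg Subtype.val ε.mul_inv) h

theorem mul_indecomposable {x : K} (he : IsTotallyPositiveUnit O e) (h : IndecomposableIn O x) :
    IndecomposableIn O (e * x) := by
  refine ⟨O.mul_mem he.2.1 h.1, totallyPositive_mul he.2.2.2 h.2.1, ?_⟩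
  rintro ⟨y, z, hy, hyp, hz, hzp, hyz⟩
  refine h.2.2 ⟨e⁻¹ * y, e⁻¹ * z, O.mul_mem he.2.2.1 hy,
    totallyPositive_mul he.inv.2.2.2 hyp, O.mul_mem he.2.2.1 hz,
    totallyPositive_mul he.inv.2.2.2 hzp, ?_⟩
  rw [← mul_add, ← hyz, inv_mul_cancel_left₀ he.1]

end IsTotallyPositiveUnit

/-! ### The cubic polynomial and its field -/

theorem thomasCubic_natDegree (a b : ℤ) : (thomasCubic a b).natDegree = 3 := by
  unfold thomasCubic; compute_degree!

theorem thomasCubic_monic (a b : ℤ) : (thomasCubic a b).Monic := by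
  unfold thomasCubic; monicity!

theorem aeval_thomasCubic {A : Type*} [CommRing A] (a b : ℤ) (x : A) :
    aeval x (thomasCubic a b) = x * (x - a) * (x - b) - 1 := by
  simp [thomasCubic]
  ring

theorem irreducible_thomasCubic {a b : ℤ} (ha : 2 ≤ a) (hab : a ≤ b - 2) :
    Irreducible ((thomasCubic a b).map (Int.castRingHom ℚ)) := by
  apply irreducible_of_degree_le_three_of_not_isRoot
  · rw [(thomasCubic_monic a b).natDegree_map, thomasCubic_natDegree]; decide
  · intro q hq
    have hq' : aeval q (thomasCubic a b) = 0 := by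
      rw [aeval_def, ← eval_map]; exact hq
    obtain ⟨n, rfl, -⟩ := exists_integer_of_is_root_of_monic (thomasCubic_monic a b) hq'
    rw [aeval_thomasCubic] at hq'
    have h : n * ((n - a) * (n - b)) = 1 := by
      have : (n : ℚ) * ((n - a) * (n - b)) = 1 := by
        simp only [algebraMap_int_eq, eq_intCast] at hq'
        linarith
      exact_mod_cast this
    rcases Int.isUnit_iff.1 (IsUnit.of_mul_eq_one _ h) with rfl | rfl <;> nlinarith

section Cubic

variable {K : Type*} [Field K] {a b : ℤ} {ρ : K}

/-- Irreducibility makes every real root a conjugate of `ρ`, so total positivity may be tested at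
all of `r₁, r₂, r₃`. -/
theorem exists_embedding [CharZero K] (ha : 2 ≤ a) (hab : a ≤ b - 2)
    (hρ : aeval ρ (thomasCubic a b) = 0) (hK : IntermediateField.adjoin ℚ {ρ} = ⊤) {r : ℝ}
    (hr : r * (r - a) * (r - b) = 1) : ∃ σ : K →+* ℝ, σ ρ = r := by
  set p := (thomasCubic a b).map (Int.castRingHom ℚ)
  have hpm : p.Monic := (thomasCubic_monic a b).map _
  have hpρ : aeval ρ p = 0 := by
    rw [← hρ]; exact aeval_map_algebraMap ℚ ρ _
  have hpr : aeval r p = 0 := by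
    refine (aeval_map_algebraMap ℚ r _).trans ?_
    rw [aeval_thomasCubic, hr, sub_self]
  have hmin : p = minpoly ℚ ρ :=
    minpoly.eq_of_irreducible_of_monic (irreducible_thomasCubic ha hab) hpρ hpm
  have hint : IsIntegral ℚ ρ := ⟨p, hpm, hpρ⟩
  have hmem : r ∈ (minpoly ℚ ρ).aroots ℝ := by
    rw [mem_aroots]; exact ⟨minpoly.ne_zero hint, hmin ▸ hpr⟩
  let φ := (IntermediateField.algHomAdjoinIntegralEquiv ℚ hint).symm ⟨r, hmem⟩
  let e : K →ₐ[ℚ] IntermediateField.adjoin ℚ {ρ} :=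
    ((IntermediateField.equivOfEq hK).trans IntermediateField.topEquiv).symm.toAlgHom
  refine ⟨(φ.comp e).toRingHom, ?_⟩
  have he : e ρ = IntermediateField.AdjoinSimple.gen ℚ ρ := by
    apply ((IntermediateField.equivOfEq hK).trans IntermediateField.topEquiv).injective
    exact ((IntermediateField.equivOfEq hK).trans
      IntermediateField.topEquiv).apply_symm_apply ρ
  change φ (e ρ) = r
  rw [he]
  exact IntermediateField.algHomAdjoinIntegralEquiv_symm_apply_gen ℚ hint ⟨r, hmem⟩

/-- The element `x + k ρ + w ρ (b - ρ)`. -/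
def coordElt (b : ℤ) (ρ : K) (x k w : ℤ) : K := x + k * ρ + w * (ρ * (b - ρ))

theorem map_coordElt (σ : K →+* ℝ) (x k w : ℤ) :
    σ (coordElt b ρ x k w) = x + k * σ ρ + w * (σ ρ * (b - σ ρ)) := by
  simp [coordElt]

theorem coordElt_sub (x k w x' k' w' : ℤ) :
    coordElt b ρ x k w - coordElt b ρ x' k' w' = coordElt b ρ (x - x') (k - k') (w - w') := by
  simp only [coordElt]; push_cast; ring

theorem self_mem : ρ ∈ Algebra.adjoin ℤ {ρ} := Algebra.subset_adjoin rfl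

theorem coordElt_mem (x k w : ℤ) : coordElt b ρ x k w ∈ Algebra.adjoin ℤ {ρ} := by
  have h := self_mem (ρ := ρ)
  have hz := intCast_mem (Algebra.adjoin ℤ {ρ})
  exact add_mem (add_mem (hz _) (mul_mem (hz _) h))
    (mul_mem (hz _) (mul_mem h (sub_mem (hz _) h)))

theorem exists_coordElt (h : ρ * (ρ - a) * (ρ - b) = 1) {t : K}
    (ht : t ∈ Algebra.adjoin ℤ {ρ}) : ∃ x k w : ℤ, t = coordElt b ρ x k w := by
  suffices ∃ x y z : ℤ, t = x + y * ρ + z * ρ ^ 2 by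
    obtain ⟨x, y, z, rfl⟩ := this
    refine ⟨x, y + b * z, -z, ?_⟩
    simp only [coordElt]; push_cast; ring
  induction ht using Algebra.adjoin_induction with
  | mem t ht => rw [Set.mem_singleton_iff] at ht; exact ⟨0, 1, 0, by simp [ht]⟩
  | algebraMap n => exact ⟨n, 0, 0, by simp⟩
  | add s t _ _ hs ht =>
    obtain ⟨x, y, z, rfl⟩ := hs
    obtain ⟨x', y', z', rfl⟩ := ht
    exact ⟨x + x', y + y', z + z', by push_cast; ring⟩
  | mul s t _ _ hs ht =>
    obtain ⟨x, y, z, rfl⟩ := hs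
    obtain ⟨x', y', z', rfl⟩ := ht
    -- The coefficients come from reducing `ρ³` and `ρ⁴` modulo the cubic.
    refine ⟨x * x' + (y * z' + z * y') + z * z' * (a + b),
      x * y' + y * x' - a * b * (y * z' + z * y') + z * z' * (1 - a * b * (a + b)),
      x * z' + y * y' + z * x' + (a + b) * (y * z' + z * y') +
        z * z' * ((a + b) ^ 2 - a * b), ?_⟩
    push_cast
    linear_combination (y * z' + z * y' + z * z' * (ρ + a + b) : K) * h

theorem root_of_embedding (h : ρ * (ρ - a) * (ρ - b) = 1) (σ : K →+* ℝ) :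
    σ ρ * (σ ρ - a) * (σ ρ - b) = 1 := by
  simpa using congrArg σ h

theorem totallyPositive_root (ha : 2 ≤ a) (hab : a ≤ b - 2)
    (h : ρ * (ρ - a) * (ρ - b) = 1) : TotallyPositive ρ := fun σ =>
  root_pos (by exact_mod_cast ha) (by exact_mod_cast hab) (root_of_embedding h σ)

theorem InCone.totallyPositive {x k w : ℤ} (hc : InCone a b x k w) (ha : 2 ≤ a)
    (hab : a ≤ b - 2) (h : ρ * (ρ - a) * (ρ - b) = 1) (h0 : ¬ (x = 0 ∧ k = 0 ∧ w = 0)) :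
    TotallyPositive (coordElt b ρ x k w) := fun σ => by
  rw [map_coordElt]
  exact hc.pos ha hab h0 (root_of_embedding h σ)

theorem isTotallyPositiveUnit_root (ha : 2 ≤ a) (hab : a ≤ b - 2)
    (h : ρ * (ρ - a) * (ρ - b) = 1) : IsTotallyPositiveUnit (Algebra.adjoin ℤ {ρ}) ρ := by
  have hz := intCast_mem (Algebra.adjoin ℤ {ρ})
  refine .of_mul_eq_one self_mem (f := (ρ - a) * (ρ - b))
    (mul_mem (sub_mem self_mem (hz _)) (sub_mem self_mem (hz _))) ?_
    (totallyPositive_root ha hab h)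
  rw [← mul_assoc, h]

theorem isTotallyPositiveUnit_unit (ha : 2 ≤ a) (hab : a ≤ b - 2)
    (h : ρ * (ρ - a) * (ρ - b) = 1) :
    IsTotallyPositiveUnit (Algebra.adjoin ℤ {ρ}) (ρ * (ρ - b) ^ 2) := by
  have hz := intCast_mem (Algebra.adjoin ℤ {ρ})
  refine .of_mul_eq_one (f := ρ * (ρ - a) ^ 2)
    (mul_mem self_mem (pow_mem (sub_mem self_mem (hz _)) 2))
    (mul_mem self_mem (pow_mem (sub_mem self_mem (hz _)) 2)) ?_ fun σ => ?_
  · linear_combination (ρ * (ρ - a) * (ρ - b) + 1) * h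
  · have h1 := totallyPositive_root ha hab h σ
    have h2 := root_of_embedding h σ
    have h3 : σ ρ - b ≠ 0 := by intro h3; rw [h3] at h2; norm_num at h2
    simp only [map_mul, map_pow, map_sub, map_intCast]
    positivity

theorem indecomposable_coordElt [CharZero K] (ha : 2 ≤ a) (hab : a ≤ b - 2)
    (hρ : aeval ρ (thomasCubic a b) = 0) (hK : IntermediateField.adjoin ℚ {ρ} = ⊤)
    {v w : ℤ} (h0 : 0 ≤ v) (hv : v ≤ b - a - 1) (hw : v * a ≤ w) (hw' : w ≤ (v + 1) * a - 1) :
    IndecomposableIn (Algebra.adjoin ℤ {ρ}) (coordElt b ρ (-v) 1 w) := by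
  have h : ρ * (ρ - a) * (ρ - b) = 1 := by
    rw [aeval_thomasCubic] at hρ; exact sub_eq_zero.1 hρ
  have haR : (2 : ℝ) ≤ a := by exact_mod_cast ha
  have habR : (a : ℝ) ≤ b - 2 := by exact_mod_cast hab
  refine ⟨coordElt_mem _ _ _, InCone.totallyPositive ⟨by omega, ?_, by linarith, ?_⟩ ha hab h
    (by omega), ?_⟩
  · have := mul_nonneg h0 (show 0 ≤ a by omega)
    omega
  · have h1 : (v + 1) * a ≤ (b - a) * a := mul_le_mul_of_nonneg_right (by omega) (by omega)
    have h2 : (b - a) * (a + 1) ≤ (b - a) * (-v + b * 1) :=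
      mul_le_mul_of_nonneg_left (by omega) (by omega)
    linarith
  · rintro ⟨y, z, hy, hyp, hz, hzp, hyz⟩
    obtain ⟨x, k, l, rfl⟩ := exists_coordElt h hy
    obtain rfl : z = _ := by rw [← add_sub_cancel_left (coordElt b ρ x k l) z, ← hyz, coordElt_sub]
    obtain ⟨r₁, r₂, r₃, hr⟩ := exists_orderedRoots haR habR
    obtain ⟨σ₁, s1⟩ := exists_embedding ha hab hρ hK hr.eq₁
    obtain ⟨σ₂, s2⟩ := exists_embedding ha hab hρ hK hr.eq₂
    obtain ⟨σ₃, s3⟩ := exists_embedding ha hab hρ hK hr.eq₃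
    have p1 := hyp σ₁; have p2 := hyp σ₂; have p3 := hyp σ₃
    have q1 := hzp σ₁; have q2 := hzp σ₂; have q3 := hzp σ₃
    rw [map_coordElt, s1] at p1 q1
    rw [map_coordElt, s2] at p2 q2
    rw [map_coordElt, s3] at p3 q3
    rcases le_or_gt k 0 with hk | hk
    · exact hr.false_of_add rfl haR habR p1 p2 p3 q1 q2 q3 hk (by omega) (by linarith)
    · exact hr.false_of_add rfl haR habR q1 q2 q3 p1 p2 p3 (by omega) (by omega) (by linarith)

theorem exists_mul_eq_coordElt [CharZero K] (ha : 2 ≤ a) (hab : a ≤ b - 2)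
    (hρ : aeval ρ (thomasCubic a b) = 0) (hK : IntermediateField.adjoin ℚ {ρ} = ⊤) {t : K}
    (ht : t ∈ Algebra.adjoin ℤ {ρ}) (htp : TotallyPositive t) :
    ∃ (e : K) (x k w : ℤ), IsTotallyPositiveUnit (Algebra.adjoin ℤ {ρ}) e ∧
      InCone a b x k w ∧ e * t = coordElt b ρ x k w := by
  have h : ρ * (ρ - a) * (ρ - b) = 1 := by
    rw [aeval_thomasCubic] at hρ; exact sub_eq_zero.1 hρ
  have haR : (2 : ℝ) ≤ a := by exact_mod_cast ha
  have habR : (a : ℝ) ≤ b - 2 := by exact_mod_cast hab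
  obtain ⟨r₁, r₂, r₃, hr⟩ := exists_orderedRoots haR habR
  obtain ⟨σ₁, s1⟩ := exists_embedding ha hab hρ hK hr.eq₁
  obtain ⟨σ₂, s2⟩ := exists_embedding ha hab hρ hK hr.eq₂
  obtain ⟨σ₃, s3⟩ := exists_embedding ha hab hρ hK hr.eq₃
  obtain ⟨n, m, y₁, y₂, y₃, hy₁, hy₂, hy₃, i₁, i₂, i₃, i₄⟩ :=
    (hr.unitPair haR habR).exists_zpow_mem_cone (htp σ₁) (htp σ₂) (htp σ₃)
  have he := ((isTotallyPositiveUnit_root ha hab h).zpow n).mul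
    ((isTotallyPositiveUnit_unit ha hab h).zpow m)
  obtain ⟨x, k, w, hxkw⟩ := exists_coordElt h (mul_mem he.2.1 ht)
  have key : ∀ (σ : K →+* ℝ) (r : ℝ), σ ρ = r → r ^ n * (r * (r - b) ^ 2) ^ m * σ t =
      x + k * r + w * (r * (b - r)) := by
    rintro σ r rfl
    rw [← map_coordElt, ← hxkw]
    simp [map_zpow₀]
  obtain ⟨c1, c2, c3, c4⟩ := hr.coord_cone haR habR (hy₁.trans (key _ _ s1))
    (hy₂.trans (key _ _ s2)) (hy₃.trans (key _ _ s3)) i₁ i₂ i₃ i₄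
  exact ⟨_, x, k, w, he, ⟨by exact_mod_cast c1, by exact_mod_cast c2, by exact_mod_cast c3,
    by exact_mod_cast c4⟩, hxkw⟩

theorem exists_coordElt_of_indecomposable [CharZero K] (ha : 2 ≤ a) (hab : a ≤ b - 2)
    (hρ : aeval ρ (thomasCubic a b) = 0) (hK : IntermediateField.adjoin ℚ {ρ} = ⊤) {t : K}
    (ht : IndecomposableIn (Algebra.adjoin ℤ {ρ}) t) :
    ∃ (e : K) (v w : ℤ), IsTotallyPositiveUnit (Algebra.adjoin ℤ {ρ}) e ∧
      0 ≤ v ∧ v ≤ b - a - 1 ∧ v * a ≤ w ∧ w ≤ (v + 1) * a - 1 ∧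
      e * t = coordElt b ρ (-v) 1 w := by
  have h : ρ * (ρ - a) * (ρ - b) = 1 := by
    rw [aeval_thomasCubic] at hρ; exact sub_eq_zero.1 hρ
  obtain ⟨e, x, k, w, he, hc, het⟩ := exists_mul_eq_coordElt ha hab hρ hK ht.1 ht.2.1
  have hR := isTotallyPositiveUnit_root ha hab h
  have hU := isTotallyPositiveUnit_unit ha hab h
  have hi := he.mul_indecomposable ht
  have h0 : ¬ (x = 0 ∧ k = 0 ∧ w = 0) := by
    rintro ⟨rfl, rfl, rfl⟩
    obtain ⟨r₁, r₂, r₃, hr⟩ := exists_orderedRoots (a := a) (b := b) (by exact_mod_cast ha)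
      (by exact_mod_cast hab)
    obtain ⟨σ, -⟩ := exists_embedding ha hab hρ hK hr.eq₁
    have := hi.2.1 σ
    rw [het, map_coordElt] at this
    simp at this
  rcases hc.cases ha hab h0 with ⟨rfl, rfl, hw, hw'⟩ | ⟨rfl, h1, h2, h3, h4⟩ | ⟨rfl, rfl, rfl⟩ |
    ⟨x', k', w', hc', h0', hc'', h0''⟩
  · rcases hw'.eq_or_lt with rfl | hw'
    -- The point is `u` itself; `u⁻¹ρ` carries it to `ρ`, the case `v = w = 0`.
    · refine ⟨(ρ * (ρ - b) ^ 2)⁻¹ * ρ * e, 0, 0, (hU.inv.mul hR).mul he, le_rfl, by omega, by omega,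
        by omega, ?_⟩
      rw [mul_assoc _ e, het, mul_assoc, inv_mul_eq_iff_eq_mul₀ hU.1]
      simp only [coordElt]
      push_cast
      linear_combination -ρ * h
    -- Multiplication by `ρ` sends `(1, 0, w)` to `(-w, 1, wa)`, because `ρ·ρ(b - ρ) = aρ(b - ρ) -
    -- 1`.
    · refine ⟨ρ * e, w, w * a, hR.mul he, hw, by omega, le_rfl, by linarith, ?_⟩
      rw [mul_assoc, het]
      simp only [coordElt]
      push_cast
      linear_combination (-w : K) * h
  · exact ⟨e, -x, w, he, h1, h2, h3, h4, by rw [het, neg_neg]⟩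
  -- The point is `ρu`, an associate of `ρ`.
  · refine ⟨(ρ * (ρ - b) ^ 2)⁻¹ * e, 0, 0, hU.inv.mul he, le_rfl, by omega, by omega, by omega, ?_⟩
    rw [mul_assoc, het, inv_mul_eq_iff_eq_mul₀ hU.1]
    simp only [coordElt]
    push_cast
    linear_combination (b - a - ρ : K) * h
  · exact absurd ⟨_, _, coordElt_mem x' k' w', hc'.totallyPositive ha hab h h0',
      coordElt_mem _ _ _, hc''.totallyPositive ha hab h h0'', by
        rw [het, ← coordElt_sub, add_sub_cancel]⟩ hi.2.2

end Cubic

/-! ### The classification -/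

theorem mainTheorem3 {K : Type*} [Field K] [NumberField K] (a b : ℤ) (ha : 2 ≤ a)
    (hab : a ≤ b - 2) (ρ : K) (hρ : Polynomial.aeval ρ (thomasCubic a b) = 0)
    (hK : IntermediateField.adjoin ℚ {ρ} = ⊤) (x : K) :
    IndecomposableIn (Algebra.adjoin ℤ {ρ}) x ↔
      ∃ v w : ℤ, 0 ≤ v ∧ v ≤ b - a - 1 ∧ v * a ≤ w ∧ w ≤ (v + 1) * a - 1 ∧
        ∃ ε : (Algebra.adjoin ℤ {ρ})ˣ, TotallyPositive ((ε : Algebra.adjoin ℤ {ρ}) : K) ∧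
          x = ((ε : Algebra.adjoin ℤ {ρ}) : K) *
            (-(v : K) + ((b : K) * (w : K) + 1) * ρ - (w : K) * ρ ^ 2) := by
  have helt : ∀ v w : ℤ, -(v : K) + ((b : K) * (w : K) + 1) * ρ - (w : K) * ρ ^ 2 =
      coordElt b ρ (-v) 1 w := fun v w => by
    simp only [coordElt]; push_cast; ring
  simp only [helt]
  constructor
  · intro hx
    obtain ⟨e, v, w, he, h1, h2, h3, h4, hex⟩ :=
      exists_coordElt_of_indecomposable ha hab hρ hK hx
    obtain ⟨ε, hε, hεe⟩ := he.inv.exists_unit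
    exact ⟨v, w, h1, h2, h3, h4, ε, hε, by rw [hεe, ← hex, inv_mul_cancel_left₀ he.1]⟩
  · rintro ⟨v, w, h1, h2, h3, h4, ε, hε, rfl⟩
    exact (IsTotallyPositiveUnit.of_unit ε hε).mul_indecomposable
      (indecomposable_coordElt ha hab hρ hK h1 h2 h3 h4)
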